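/- Let $p\in(0,1)$. Let $\mu_p$ be the Bernoulli product measure on $\{0,1\}^{\mathbb Z}$ under which each site is occupied (has value $1$) with probability $p$. Let $T:\{0,1\}^{\mathbb Z}\to\{0,1\}^{\mathbb Z}$ be the map that removes isolated occupied sites, $(T\omega)_i=\omega_i\bigl(1-(1-\omega_{i-1})(1-\omega_{i+1})\bigr)$, and let $\mu'_p=\mu_p\circ T^{-1}$ be the thinned Bernoulli field. Put $$\lambda_{\mathrm{PF}}=\tfrac12\Bigl(1-p+\sqrt{(1-p)(3p+1)}\Bigr),\qquad \lambda_{\mathrm r}=\tfrac12\Bigl(1-p-\sqrt{(1-p)(3p+1)}\Bigr),\qquad a=\lambda_{\mathrm r}/\lambda_{\mathrm{PF}},$$ and define $g_p:\mathbb N_0\cup\{\infty\}\to\mathbb R$ by $g_p(0)=0$, $g_p(1)=1-p$, $g_p(\infty)=\lambda_{\mathrm{PF}}$ and, for $2\le n<\infty$, $$g_p(n)=\frac{(-1)^{n+1}|a|^n\frac{\lambda_{\mathrm{PF}}}{1-\lambda_{\mathrm r}}+\frac{\lambda_{\mathrm{PF}}}{1-\lambda_{\mathrm{PF}}}}{(-1)^n|a|^{n-1}\frac1{1-\lambda_{\mathrm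 r}}+\frac1{1-\lambda_{\mathrm{PF}}}} .$$ The generalized house-of-cards (GHoC) chain is the Markov chain on $\mathbb N_0\cup\{\infty\}$ with transition probabilities $$\Pi_p(0,1)=1,\qquad \Pi_p(1,1)=p,\qquad \Pi_p(1,2)=1-p,$$ $$\Pi_p(i,i+1)=g_p(i),\qquad \Pi_p(i,0)=1-g_p(i)\qquad (2\le i\le\infty,\ \infty+1=\infty),$$ and $\Pi_p(i,j)=0$ in all other cases. Then the GHoC chain indexed by $\mathbb Z$ has a unique stationary distribution on path space, i.e. there is exactly one shift-invariant probability measure $\mathbb P^{\mathrm{GHoC}}_p$ on $(\mathbb N_0\cup\{\infty\})^{\mathbb Z}$ (with the product $\sigma$-algebra) under which the coordinate process is a Markov chain with transition matrix $\Pi_p$. Moreover, with $\tau:\mathbb N_0\cup\{\infty\}\to\{0,1\}$, $\tau(n)=\mathbf 1_{\{0,1\}}(n)$, applied coordinatewise, $\tau(\mathbb P^{\mathrm{GHoC}}_p)=\mu'_p$. That is, if $(n_i)_{i\in\mathbb Z}$ is a random sequence with law $\mathbb P^{\mathrm{GHoC}}_p$, then $(\tau(n_i))_{i\in\mathbb Z}$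 has law $\mu'_p$. -/

import Mathlib

open MeasureTheory ProbabilityTheory
open scoped unitInterval

noncomputable section

/-- Spin configurations on the line. -/
abbrev SpinConfig : Type := ℤ → Fin 2

/-- The Bernoulli-`p` product measure on `{0,1}^ℤ`; `p` is the probability of the value `1`. -/
def bernoulliField (p : I) : Measure SpinConfig :=
  Measure.infinitePi fun _ : ℤ => bernoulliMeasure (1 : Fin 2) 0 p

/-- Removal of isolated occupied sites: an occupied site stays occupied if and only if at least
one of its two neighbours is occupied. -/
def thinning (ω : SpinConfig) : SpinConfig := fun i =>
  if ω i = 1 ∧ (ω (i - 1) = 1 ∨ ω (i + 1) = 1) then 1 else 0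

/-- The thinned Bernoulli field: the image of the Bernoulli field under thinning. -/
def thinnedBernoulliField (p : I) : Measure SpinConfig :=
  (bernoulliField p).map thinning

/-- The Perron-Frobenius eigenvalue of the matrix with rows `(1 - p, √(p (1 - p)))` and
`(√(p (1 - p)), 0)`. -/
def lambdaPF (p : ℝ) : ℝ := (1 - p + √((1 - p) * (3 * p + 1))) / 2

/-- The other eigenvalue of the same matrix. -/
def lambdaR (p : ℝ) : ℝ := (1 - p - √((1 - p) * (3 * p + 1))) / 2

/-- The eigenvalue ratio `a(p)`. -/
def eigenvalueRatio (p : ℝ) : ℝ := lambdaR p / lambdaPF p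

/-- The `g`-function of the thinned Bernoulli field, as a function of the distance `n` to the
nearest pair of occupied sites in the past. The value at `∞` is the general formula with
`|a| ^ ∞ = 0`, which is `lambdaPF p`. -/
def gFun (p : ℝ) (n : ℕ∞) : ℝ :=
  if n = 0 then 0
  else if n = 1 then 1 - p
  else if n = ⊤ then lambdaPF p
  else
    ((-1) ^ (n.toNat + 1) * |eigenvalueRatio p| ^ n.toNat * (lambdaPF p / (1 - lambdaR p))
        + lambdaPF p / (1 - lambdaPF p)) /
      ((-1) ^ n.toNat * |eigenvalueRatio p| ^ (n.toNat - 1) * (1 / (1 - lambdaR p))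
        + 1 / (1 - lambdaPF p))

/-- The transition matrix of the generalized house-of-cards chain (here `⊤ + 1 = ⊤`): the state
`0` moves to `1` with probability one, the state `1` stays with probability `p` and moves to `2`
with probability `1 - p`, and every state `i ≥ 2` (`⊤` included) moves to `i + 1` with
probability `gFun p i` and to `0` otherwise. -/
def ghocTransition (p : ℝ) (i j : ℕ∞) : ℝ :=
  if i = 0 then (if j = 1 then 1 else 0)
  else if j = i + 1 then gFun p i
  else if j = 0 ∧ i ≠ 1 then 1 - gFun p i
  else if i = 1 ∧ j = 1 then p
  else 0

/-- `P` is a stationary distribution on path space of the Markov chain on `S`, indexed by `ℤ`,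
with transition matrix `K`: a shift-invariant probability measure on `S^ℤ` under which
the conditional probability of `x (m + k + 1) = s (k + 1)` given
`x m = s 0, …, x (m + k) = s k` is `K (s k) (s (k + 1))`, whenever the conditioning event has
positive probability. -/
structure IsStationaryMarkovLaw {S : Type*} [MeasurableSpace S] (K : S → S → ℝ)
    (P : Measure (ℤ → S)) : Prop where
  isProbabilityMeasure : IsProbabilityMeasure P
  stationary : P.map (fun (x : ℤ → S) (n : ℤ) => x (n + 1)) = P
  markov : ∀ (m : ℤ) (k : ℕ) (s : ℕ → S),
    P.real {x | ∀ i ≤ k + 1, x (m + (i : ℤ)) = s i} =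
      P.real {x | ∀ i ≤ k, x (m + (i : ℤ)) = s i} * K (s k) (s (k + 1))

/-- The local map `τ`, the indicator function of `{0, 1}`. -/
def tau (n : ℕ∞) : Fin 2 := if n = 0 ∨ n = 1 then 1 else 0

end

/-! The thinned configuration `η` is encoded by the path `gapState η`: 0 marks the start of an
occupied run, 1 its continuation, and on empty sites the state counts upward from 2. Applying `tau`
recovers `η`, so it suffices that the encoded thinned field is the GHoC chain and that this chain
has only one stationary law.

For existence, the state at `i` is read off the Bernoulli sites up to `i + 1`, so what matters about
the past is the conditional probability that `i + 1` is empty. This depends only on the current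
state: 0 in state 0, `1 - p` in states 1 and 2. From a state `n ≥ 2` the chain jumps to 0 exactly
when `i + 1` and `i + 2` are both occupied; an empty `i + 2` prevents this, so Bayes' rule gives
`emptyProb (n + 1) = (1 - p) / gFun n`. The explicit `gFun` solves this recursion because it is a
ratio of consecutive terms of a linear recurrence with roots `lambdaPF` and `lambdaR`.
`IsHistory.step` propagates the invariant along arbitrary histories, which is the Markov property.

For uniqueness, each state `n + 1 ≥ 2` has `n` as its only predecessor, so stationarity fixes all
one-site weights up to scale and gives ∞ weight 0, since `lambdaPF < 1`. Normalisation fixes the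
scale, and one-site weights determine the path law. -/

/-! ### Encoding configurations by state paths -/

/-- The distance from `i` to the nearest occupied site at or to the left of `i`. -/
noncomputable def lastOccupied (η : SpinConfig) (i : ℤ) : ℕ∞ :=
  ⨅ k : ℕ, if η (i - k) = 1 then (k : ℕ∞) else ⊤

/-- The state at `i` of the generalized house-of-cards path encoding the configuration `η`. -/
noncomputable def gapState (η : SpinConfig) (i : ℤ) : ℕ∞ :=
  if η i = 1 then (if η (i - 1) = 1 then 1 else 0) else lastOccupied η i + 1

lemma lastOccupied_eq_zero {η : SpinConfig} {i : ℤ} (h : η i = 1) : lastOccupied η i = 0 := by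
  refine le_antisymm (iInf_le_of_le 0 ?_) bot_le
  simp [h]

lemma lastOccupied_add_one {η : SpinConfig} {i : ℤ} (h : η (i + 1) ≠ 1) :
    lastOccupied η (i + 1) = lastOccupied η i + 1 := by
  unfold lastOccupied
  rw [← inf_iInf_nat_succ, ENat.iInf_add]
  simp only [Nat.cast_zero, sub_zero, if_neg h, top_inf_eq]
  refine iInf_congr fun k => ?_
  have : i + 1 - ((k + 1 : ℕ) : ℤ) = i - k := by push_cast; ring
  rw [this]
  split_ifs <;> simp

lemma gapState_of_eq_one {η : SpinConfig} {i : ℤ} (h : η i = 1) (h' : η (i + 1) ≠ 1) :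
    gapState η (i + 1) = 2 := by
  rw [gapState, if_neg h', lastOccupied_add_one h', lastOccupied_eq_zero h]
  norm_num

lemma gapState_of_ne_one {η : SpinConfig} {i : ℤ} (h : η i ≠ 1) (h' : η (i + 1) ≠ 1) :
    gapState η (i + 1) = gapState η i + 1 := by
  rw [gapState, if_neg h', lastOccupied_add_one h', gapState, if_neg h]

lemma two_le_gapState {η : SpinConfig} {i : ℤ} (h : η i ≠ 1) : 2 ≤ gapState η i := by
  obtain ⟨j, rfl⟩ : ∃ j, i = j + 1 := ⟨i - 1, by ring⟩
  rw [gapState, if_neg h, lastOccupied_add_one h, add_assoc, one_add_one_eq_two]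
  exact le_add_self

lemma gapState_eq_zero_iff {η : SpinConfig} {i : ℤ} :
    gapState η i = 0 ↔ η i = 1 ∧ η (i - 1) ≠ 1 := by
  by_cases h : η i = 1
  · by_cases h' : η (i - 1) = 1 <;> simp [gapState, h, h']
  · have := two_le_gapState h
    simp only [h, false_and, iff_false]
    rintro h0
    simp [h0] at this

lemma gapState_eq_one_iff {η : SpinConfig} {i : ℤ} :
    gapState η i = 1 ↔ η i = 1 ∧ η (i - 1) = 1 := by
  by_cases h : η i = 1
  · by_cases h' : η (i - 1) = 1 <;> simp [gapState, h, h']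
  · have := two_le_gapState h
    simp only [h, false_and, iff_false]
    rintro h0
    rw [h0] at this
    norm_num at this

lemma tau_gapState (η : SpinConfig) (i : ℤ) : tau (gapState η i) = η i := by
  simp only [tau, gapState_eq_zero_iff, gapState_eq_one_iff]
  have : ∀ x : Fin 2, x ≠ 1 → x = 0 := by decide
  by_cases h : η i = 1
  · simp [h, em']
  · simp [this _ h]

lemma gapState_shift (η : SpinConfig) (i : ℤ) :
    gapState (fun j => η (j + 1)) i = gapState η (i + 1) := by
  simp only [gapState, lastOccupied, sub_add_eq_add_sub]

lemma thinning_eq_one_iff {ω : SpinConfig} {i : ℤ} :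
    thinning ω i = 1 ↔ ω i = 1 ∧ (ω (i - 1) = 1 ∨ ω (i + 1) = 1) := by
  unfold thinning
  split_ifs with h <;> simp [h]

/-- If `i - 1` were occupied in `ω`, its neighbour `i` would make it survive thinning. Hence `i`
owes its survival to `i + 1`, which then survives as well. -/
lemma gapState_thinning_of_eq_zero {ω : SpinConfig} {i : ℤ} (h : gapState (thinning ω) i = 0) :
    ω (i + 1) = 1 ∧ gapState (thinning ω) (i + 1) = 1 := by
  simp only [gapState_eq_zero_iff, gapState_eq_one_iff, thinning_eq_one_iff, add_sub_cancel_right,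
    sub_add_cancel, ne_eq] at h ⊢
  tauto

/-- Adjacent occupied sites protect each other. State 1 therefore needs no look-ahead to `i + 1`,
unlike the other states. -/
lemma gapState_thinning_eq_one_iff {ω : SpinConfig} {i : ℤ} :
    gapState (thinning ω) i = 1 ↔ ω i = 1 ∧ ω (i - 1) = 1 := by
  simp only [gapState_eq_one_iff, thinning_eq_one_iff, sub_add_cancel]
  tauto

lemma gapState_thinning_of_eq_one {ω : SpinConfig} {i : ℤ} (h : gapState (thinning ω) i = 1) :
    gapState (thinning ω) (i + 1) = if ω (i + 1) = 1 then 1 else 2 := by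
  rw [gapState_thinning_eq_one_iff] at h
  split_ifs with h'
  · rw [gapState_thinning_eq_one_iff]
    simp [h, h']
  · refine gapState_of_eq_one ?_ ?_ <;> simp only [ne_eq, thinning_eq_one_iff] <;> tauto

/-- Since `i` is empty after thinning, it cannot protect `i + 1`: were both occupied in `ω`, `i`
would have survived. Only `i + 2` can. -/
lemma gapState_thinning_of_two_le {ω : SpinConfig} {i : ℤ} (h0 : gapState (thinning ω) i ≠ 0)
    (h1 : gapState (thinning ω) i ≠ 1) :
    gapState (thinning ω) (i + 1) =
      if ω (i + 1) = 1 ∧ ω (i + 1 + 1) = 1 then 0 else gapState (thinning ω) i + 1 := by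
  have h : thinning ω i ≠ 1 := by
    rw [Ne, gapState_eq_zero_iff] at h0
    rw [Ne, gapState_eq_one_iff] at h1
    tauto
  split_ifs with h'
  · rw [gapState_eq_zero_iff, add_sub_cancel_right, thinning_eq_one_iff]
    tauto
  · refine gapState_of_ne_one h ?_
    rw [Ne, thinning_eq_one_iff, add_sub_cancel_right] at *
    tauto

lemma gapState_thinning_sub_one {ω : SpinConfig} {i : ℤ} {n : ℕ∞} (hn : n ≠ 0)
    (h : gapState (thinning ω) (i + 1) = n + 1) : gapState (thinning ω) i = n := by
  by_cases h0 : gapState (thinning ω) i = 0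
  · have := (gapState_thinning_of_eq_zero h0).2
    rw [this] at h
    have : (0 : ℕ∞) + 1 = n + 1 := by rwa [zero_add]
    exact absurd (ENat.add_left_injective_of_ne_top (n := 1) (by simp) this).symm hn
  by_cases h1 : gapState (thinning ω) i = 1
  · have := gapState_thinning_of_eq_one h1
    rw [h] at this
    have inj := ENat.add_left_injective_of_ne_top (n := 1) (by simp)
    split_ifs at this
    · exact absurd (inj (this.trans (zero_add 1).symm)) hn
    · rw [h1]
      exact (inj (this.trans one_add_one_eq_two.symm)).symm
  · rw [gapState_thinning_of_two_le h0 h1] at h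
    split_ifs at h
    · exact absurd h.symm (by simp)
    · exact ENat.add_left_injective_of_ne_top (n := 1) (by simp) h

/-! ### Eigenvalues, the linear recurrence and the g-function -/

lemma lambdaPF_add_lambdaR (p : ℝ) : lambdaPF p + lambdaR p = 1 - p := by
  unfold lambdaPF lambdaR
  ring

lemma lambdaPF_mul_lambdaR {p : ℝ} (hp0 : 0 < p) (hp1 : p < 1) :
    lambdaPF p * lambdaR p = -(p * (1 - p)) := by
  have h : √((1 - p) * (3 * p + 1)) ^ 2 = (1 - p) * (3 * p + 1) :=
    Real.sq_sqrt (by nlinarith)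
  unfold lambdaPF lambdaR
  linear_combination (-1 / 4 : ℝ) * h

lemma lambdaPF_pos {p : ℝ} (hp1 : p < 1) : 0 < lambdaPF p := by
  have := Real.sqrt_nonneg ((1 - p) * (3 * p + 1))
  unfold lambdaPF
  linarith

lemma lambdaR_neg {p : ℝ} (hp0 : 0 < p) (hp1 : p < 1) : lambdaR p < 0 := by
  have h := lambdaPF_mul_lambdaR hp0 hp1
  have := lambdaPF_pos hp1
  by_contra! h0
  nlinarith [mul_nonneg this.le h0, mul_pos hp0 (sub_pos.2 hp1)]

lemma one_sub_lambda_mul {p : ℝ} (hp0 : 0 < p) (hp1 : p < 1) :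
    (1 - lambdaPF p) * (1 - lambdaR p) = p ^ 2 := by
  linear_combination lambdaPF_mul_lambdaR hp0 hp1 - lambdaPF_add_lambdaR p

lemma lambdaPF_lt_one {p : ℝ} (hp0 : 0 < p) (hp1 : p < 1) : lambdaPF p < 1 := by
  have h := one_sub_lambda_mul hp0 hp1
  have := lambdaR_neg hp0 hp1
  by_contra! h0
  nlinarith [mul_nonneg (sub_nonneg.2 h0) (by linarith : 0 ≤ 1 - lambdaR p), pow_pos hp0 2]

lemma lambdaPF_sq {p : ℝ} (hp0 : 0 < p) (hp1 : p < 1) :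
    lambdaPF p ^ 2 = (1 - p) * lambdaPF p + p * (1 - p) := by
  linear_combination lambdaPF p * lambdaPF_add_lambdaR p - lambdaPF_mul_lambdaR hp0 hp1

lemma lambdaR_sq {p : ℝ} (hp0 : 0 < p) (hp1 : p < 1) :
    lambdaR p ^ 2 = (1 - p) * lambdaR p + p * (1 - p) := by
  linear_combination lambdaR p * lambdaPF_add_lambdaR p - lambdaPF_mul_lambdaR hp0 hp1

/-- Up to a constant factor, the probability that a run of empty sites in the thinned field has
length at least `k`, given that there is such a run. -/
noncomputable def gapWeight (p : ℝ) (k : ℕ) : ℝ :=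
  lambdaPF p ^ k / (1 - lambdaPF p) - lambdaR p ^ k / (1 - lambdaR p)

lemma gapWeight_add_two {p : ℝ} (hp0 : 0 < p) (hp1 : p < 1) (k : ℕ) :
    gapWeight p (k + 2) = (1 - p) * gapWeight p (k + 1) + p * (1 - p) * gapWeight p k := by
  unfold gapWeight
  rw [pow_add _ k 2, pow_add _ k 2, lambdaPF_sq hp0 hp1, lambdaR_sq hp0 hp1]
  ring

lemma gapWeight_zero_pos {p : ℝ} (hp0 : 0 < p) (hp1 : p < 1) : 0 < gapWeight p 0 := by
  have h1 := sub_pos.2 (lambdaPF_lt_one hp0 hp1)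
  have h2 := lambdaR_neg hp0 hp1
  have h3 := lambdaPF_pos hp1
  rw [gapWeight, pow_zero, pow_zero, sub_pos]
  exact one_div_lt_one_div_of_lt h1 (by linarith)

/-- Since `λ / (1 - λ) = 1 / (1 - λ) - 1`, passing from exponent 0 to 1 subtracts 1 from both terms.
-/
lemma gapWeight_one {p : ℝ} (hp0 : 0 < p) (hp1 : p < 1) : gapWeight p 1 = gapWeight p 0 := by
  have h1 := (sub_pos.2 (lambdaPF_lt_one hp0 hp1)).ne'
  have h2 : 1 - lambdaR p ≠ 0 := by linarith [lambdaR_neg hp0 hp1]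
  unfold gapWeight
  field_simp
  ring

lemma gapWeight_pos {p : ℝ} (hp0 : 0 < p) (hp1 : p < 1) (k : ℕ) : 0 < gapWeight p k := by
  suffices 0 < gapWeight p k ∧ 0 < gapWeight p (k + 1) from this.1
  induction k with
  | zero => simp [gapWeight_one hp0 hp1, gapWeight_zero_pos hp0 hp1]
  | succ k ih =>
    refine ⟨ih.2, ?_⟩
    rw [gapWeight_add_two hp0 hp1]
    have := sub_pos.2 hp1
    have := ih.1
    have := ih.2
    positivity

lemma gFun_top (p : ℝ) : gFun p ⊤ = lambdaPF p := by
  simp [gFun]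

/-- As `lambdaR < 0 < lambdaPF`, `|a| = -a` and the alternating signs cancel; clearing the powers of
`lambdaPF` leaves the weights. -/
lemma gFun_natCast_add_two {p : ℝ} (hp0 : 0 < p) (hp1 : p < 1) (k : ℕ) :
    gFun p ((k + 2 : ℕ) : ℕ∞) = gapWeight p (k + 2) / gapWeight p (k + 1) := by
  have hL := lambdaPF_pos hp1
  have hR := lambdaR_neg hp0 hp1
  have h1 := (sub_pos.2 (lambdaPF_lt_one hp0 hp1)).ne'
  have h2 : 1 - lambdaR p ≠ 0 := by linarith
  have ha : |eigenvalueRatio p| = -eigenvalueRatio p :=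
    abs_of_neg (div_neg_of_neg_of_pos hR hL)
  have n0 : ((k + 2 : ℕ) : ℕ∞) ≠ 0 := by exact_mod_cast (by omega : k + 2 ≠ 0)
  have n1 : ((k + 2 : ℕ) : ℕ∞) ≠ 1 := by exact_mod_cast (by omega : k + 2 ≠ 1)
  have hs : ∀ x : ℝ, (-1) ^ (k + 2) * (-x) ^ (k + 1) = -x ^ (k + 1) := fun x => by
    rw [pow_succ (-1 : ℝ) (k + 1), mul_right_comm, ← mul_pow]
    ring
  have hs' : ∀ x : ℝ, (-1) ^ (k + 2 + 1) * (-x) ^ (k + 2) = -x ^ (k + 2) := fun x => by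
    rw [pow_succ (-1 : ℝ) (k + 2), mul_right_comm, ← mul_pow]
    ring
  have hx : k + 2 - 1 = k + 1 := rfl
  rw [gFun, if_neg n0, if_neg n1, if_neg (ENat.natCast_ne_top _), ENat.toNat_natCast, ha, hs', hx, hs,
    ← mul_div_mul_left _ _ (pow_pos hL (k + 1)).ne']
  unfold gapWeight eigenvalueRatio
  congr 1 <;> simp only [div_pow] <;> field_simp <;> ring

lemma exists_natCast_add_two {n : ℕ∞} (h0 : n ≠ 0) (h1 : n ≠ 1) (ht : n ≠ ⊤) :
    ∃ k : ℕ, n = ((k + 2 : ℕ) : ℕ∞) := by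
  lift n to ℕ using ht
  obtain ⟨k, rfl⟩ := Nat.exists_eq_add_of_le' (by
    have : n ≠ 0 := by exact_mod_cast h0
    have : n ≠ 1 := by exact_mod_cast h1
    omega : 2 ≤ n)
  exact ⟨k, rfl⟩

lemma gFun_two {p : ℝ} (hp0 : 0 < p) (hp1 : p < 1) :
    gFun p 2 = (1 - p) + p * (1 - p) := by
  have := gFun_natCast_add_two hp0 hp1 0
  norm_num at this
  rw [this, gapWeight_add_two hp0 hp1 0, zero_add, gapWeight_one hp0 hp1, ← add_mul,
    mul_div_cancel_right₀ _ (gapWeight_zero_pos hp0 hp1).ne']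

/-- The recurrence for `gapWeight` divided by its oldest term; at `⊤` it is the characteristic
equation of `lambdaPF`. -/
lemma gFun_add_one_mul {p : ℝ} (hp0 : 0 < p) (hp1 : p < 1) {n : ℕ∞} (h0 : n ≠ 0) (h1 : n ≠ 1) :
    gFun p (n + 1) * gFun p n = (1 - p) * gFun p n + p * (1 - p) := by
  by_cases ht : n = ⊤
  · rw [ht, top_add, gFun_top, ← sq, lambdaPF_sq hp0 hp1]
  · obtain ⟨k, rfl⟩ := exists_natCast_add_two h0 h1 ht
    have : ((k + 2 : ℕ) : ℕ∞) + 1 = ((k + 1 + 2 : ℕ) : ℕ∞) := by push_cast; ring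
    rw [this, gFun_natCast_add_two hp0 hp1, gFun_natCast_add_two hp0 hp1,
      gapWeight_add_two hp0 hp1 (k + 1)]
    have h1 := (gapWeight_pos hp0 hp1 (k + 1)).ne'
    have h2 := (gapWeight_pos hp0 hp1 (k + 2)).ne'
    field_simp

/-- The probability that the site `i + 1` of the Bernoulli field is empty, given that
the house-of-cards path at `i` is in the state `n`. -/
noncomputable def emptyProb (p : ℝ) (n : ℕ∞) : ℝ :=
  if n = 0 then 0 else if n = 1 then 1 - p else (gFun p n - (1 - p)) / p

lemma emptyProb_two {p : ℝ} (hp0 : 0 < p) (hp1 : p < 1) : emptyProb p 2 = 1 - p := by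
  rw [emptyProb, if_neg (by norm_num), if_neg (by norm_num), gFun_two hp0 hp1]
  field_simp
  ring

/-- The two ways to avoid a jump to 0: `i + 2` is empty, or it is occupied while `i + 1` is empty.
-/
lemma gFun_eq {p : ℝ} (hp0 : 0 < p) {n : ℕ∞} (h0 : n ≠ 0) (h1 : n ≠ 1) :
    gFun p n = (1 - p) + p * emptyProb p n := by
  rw [emptyProb, if_neg h0, if_neg h1]
  field_simp
  ring

/-- Bayes' rule in algebraic form: an empty `i + 2` already forces the move from `n` to `n + 1`. -/
lemma emptyProb_add_one_mul {p : ℝ} (hp0 : 0 < p) (hp1 : p < 1) {n : ℕ∞} (h0 : n ≠ 0)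
    (h1 : n ≠ 1) : emptyProb p (n + 1) * gFun p n = 1 - p := by
  have h : n + 1 ≠ 1 := fun h => h0 (by
    refine ENat.add_left_injective_of_ne_top (n := 1) (by simp) ?_
    simpa using h)
  rw [emptyProb, if_neg (by simp), if_neg h, div_mul_eq_mul_div, sub_mul,
    gFun_add_one_mul hp0 hp1 h0 h1]
  field_simp
  ring

/-! ### Measurability, independence and shift invariance -/

instance isProbabilityMeasure_bernoulliField (p : I) : IsProbabilityMeasure (bernoulliField p) := by
  unfold bernoulliField
  infer_instance

/-- The σ-algebra generated by the sites up to `i`. -/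
abbrev pastSigma (i : ℤ) : MeasurableSpace SpinConfig :=
  ⨆ j ∈ Set.Iic i, MeasurableSpace.comap (fun ω : SpinConfig => ω j) inferInstance

lemma pastSigma_le (i : ℤ) : pastSigma i ≤ (inferInstance : MeasurableSpace SpinConfig) :=
  iSup₂_le fun j _ => (measurable_pi_apply j).comap_le

lemma pastSigma_mono {i j : ℤ} (h : i ≤ j) : pastSigma i ≤ pastSigma j :=
  biSup_mono fun _ hk => le_trans hk h

lemma measurable_eval_pastSigma {i j : ℤ} (h : j ≤ i) :
    Measurable[pastSigma i] (fun ω : SpinConfig => ω j) :=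
  Measurable.of_comap_le (le_iSup₂ (f := fun (j : ℤ) (_ : j ∈ Set.Iic i) =>
    MeasurableSpace.comap (fun ω : SpinConfig => ω j) inferInstance) j h)

lemma measurableSet_eval_pastSigma {i j : ℤ} (h : j ≤ i) (s : Set (Fin 2)) :
    MeasurableSet[pastSigma i] {ω : SpinConfig | ω j ∈ s} :=
  measurable_eval_pastSigma h (MeasurableSet.of_discrete (s := s))

lemma measurable_thinning_pastSigma {i j : ℤ} (h : j + 1 ≤ i) :
    Measurable[pastSigma i] (fun ω : SpinConfig => thinning ω j) := by
  refine Measurable.ite ?_ measurable_const measurable_const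
  refine MeasurableSet.inter (measurableSet_eval_pastSigma (by linarith) {1})
    (MeasurableSet.union (measurableSet_eval_pastSigma (by linarith) {1})
      (measurableSet_eval_pastSigma h {1}))

lemma measurable_lastOccupied_thinning {i j : ℤ} (h : j + 1 ≤ i) :
    Measurable[pastSigma i] (fun ω : SpinConfig => lastOccupied (thinning ω) j) := by
  have : BorelSpace ℕ∞ := ⟨borel_eq_top_of_countable.symm⟩
  refine Measurable.iInf fun k => Measurable.ite ?_ measurable_const measurable_const
  exact measurable_thinning_pastSigma (j := j - k) (by omega) (MeasurableSet.singleton 1)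

lemma measurable_gapState_thinning {i j : ℤ} (h : j + 1 ≤ i) :
    Measurable[pastSigma i] (fun ω : SpinConfig => gapState (thinning ω) j) := by
  refine Measurable.ite ?_ (Measurable.ite ?_ measurable_const measurable_const) ?_
  · exact measurable_thinning_pastSigma h (MeasurableSet.singleton 1)
  · exact measurable_thinning_pastSigma (by linarith) (MeasurableSet.singleton 1)
  · exact (measurable_lastOccupied_thinning h).add_const 1

lemma iIndepFun_eval_bernoulliField (p : I) :
    iIndepFun (fun (i : ℤ) (ω : SpinConfig) => ω i) (bernoulliField p) :=
  iIndepFun_infinitePi (X := fun (_ : ℤ) (x : Fin 2) => x) fun _ => measurable_id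

lemma bernoulliField_real_eval (p : I) (i : ℤ) :
    (bernoulliField p).real {ω | ω i ≠ 1} = 1 - p := by
  have h := (measurePreserving_eval_infinitePi
    (fun _ : ℤ => bernoulliMeasure (1 : Fin 2) 0 p) i).measureReal_preimage
      (s := {1}ᶜ) (MeasurableSet.of_discrete.nullMeasurableSet)
  refine h.trans ?_
  rw [bernoulliMeasure_real_apply p MeasurableSet.of_discrete]
  simp

lemma bernoulliField_real_inter_ne_one (p : I) {i : ℤ} {C : Set SpinConfig}
    (hC : MeasurableSet[pastSigma i] C) :
    (bernoulliField p).real (C ∩ {ω | ω (i + 1) ≠ 1}) = (1 - p) * (bernoulliField p).real C := by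
  have hind := indep_iSup_of_disjoint (fun j => (measurable_pi_apply j).comap_le)
    (iIndepFun_eval_bernoulliField p).iIndep
    (S := Set.Iic i) (T := {i + 1}) (by simp)
  have h2 : MeasurableSet[⨆ j ∈ ({i + 1} : Set ℤ),
      MeasurableSpace.comap (fun ω : SpinConfig => ω j) inferInstance]
      {ω : SpinConfig | ω (i + 1) ≠ 1} := by
    rw [iSup_singleton]
    exact ⟨{1}ᶜ, MeasurableSet.of_discrete, rfl⟩
  rw [measureReal_def, (Indep_iff _ _ _).1 hind C _ hC h2, ENNReal.toReal_mul, ← measureReal_def,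
    ← measureReal_def, bernoulliField_real_eval, mul_comm]

/-- Translation of configurations by one site. -/
def shift (S : Type*) (x : ℤ → S) (n : ℤ) : S := x (n + 1)

lemma measurable_shift (S : Type*) [MeasurableSpace S] : Measurable (shift S) :=
  measurable_pi_lambda _ fun _ => measurable_pi_apply _

lemma measurePreserving_shift (p : I) :
    MeasurePreserving (shift (Fin 2)) (bernoulliField p) (bernoulliField p) := by
  refine ⟨measurable_shift _, ?_⟩
  have h := ((iIndepFun_eval_bernoulliField p).precomp
    (add_left_injective (1 : ℤ))).map_fun_eq_infinitePi_map fun i => measurable_pi_apply (i + 1)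
  refine h.trans ?_
  unfold bernoulliField
  congr 1
  funext i
  exact Measure.infinitePi_map_eval _ (i + 1)

lemma thinning_shift (ω : SpinConfig) : thinning (shift _ ω) = shift _ (thinning ω) := by
  funext i
  simp only [thinning, shift, sub_add_cancel, add_sub_cancel_right]

lemma gapState_thinning_shift (ω : SpinConfig) (i : ℤ) :
    gapState (thinning (shift _ ω)) i = gapState (thinning ω) (i + 1) := by
  rw [thinning_shift]
  exact gapState_shift _ _

/-! ### Propagation of histories -/

/-- The house-of-cards path encoding the thinning of the configuration `ω`. -/
noncomputable def statePath (ω : SpinConfig) (i : ℤ) : ℕ∞ := gapState (thinning ω) i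

lemma measurableSet_statePath {i j : ℤ} (h : j + 1 ≤ i) (n : ℕ∞) :
    MeasurableSet[pastSigma i] {ω | statePath ω j = n} :=
  measurable_gapState_thinning h (MeasurableSet.singleton n)

lemma measurable_statePath : Measurable statePath :=
  measurable_pi_lambda _ fun _ =>
    (measurable_gapState_thinning le_rfl).mono (pastSigma_le _) le_rfl

lemma statePath_shift (ω : SpinConfig) (i : ℤ) :
    statePath (shift _ ω) i = statePath ω (i + 1) :=
  gapState_thinning_shift ω i

/-- The event `C` is determined by the sites up to `i + 1`, fixes the state `n` at `i`, and
its conditional probability that `i + 1` is empty is the one prescribed by `n`. -/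
structure IsHistory (p : I) (i : ℤ) (n : ℕ∞) (C : Set SpinConfig) : Prop where
  measurableSet : MeasurableSet[pastSigma (i + 1)] C
  statePath_eq : ∀ ω ∈ C, statePath ω i = n
  real_inter : (bernoulliField p).real (C ∩ {ω | ω (i + 1) ≠ 1}) =
    emptyProb p n * (bernoulliField p).real C

lemma isHistory_of_null {p : I} {i : ℤ} {n : ℕ∞} {C : Set SpinConfig}
    (hC : MeasurableSet[pastSigma (i + 1)] C) (hn : ∀ ω ∈ C, statePath ω i = n)
    (h : (bernoulliField p).real C = 0) : IsHistory p i n C := by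
  refine ⟨hC, hn, ?_⟩
  rw [h, mul_zero]
  exact le_antisymm (h ▸ measureReal_mono Set.inter_subset_left) measureReal_nonneg

/-- Site `i + 1` is independent of such an event. This covers states 1 and 2, where `emptyProb` is
`1 - p`. -/
lemma isHistory_of_past {p : I} {i : ℤ} {n : ℕ∞} {C : Set SpinConfig}
    (hC : MeasurableSet[pastSigma i] C) (hn : ∀ ω ∈ C, statePath ω i = n)
    (he : emptyProb p n = 1 - p) : IsHistory p i n C :=
  ⟨pastSigma_mono (by linarith) C hC, hn, by rw [bernoulliField_real_inter_ne_one p hC, he]⟩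

lemma bernoulliField_real_inter_eq_one {p : I} {i : ℤ} (C : Set SpinConfig) :
    (bernoulliField p).real (C ∩ {ω | ω i = 1}) =
      (bernoulliField p).real C - (bernoulliField p).real (C ∩ {ω | ω i ≠ 1}) := by
  have hm : MeasurableSet {ω : SpinConfig | ω i ≠ 1} :=
    measurable_pi_apply i (MeasurableSet.of_discrete (s := {1}ᶜ))
  rw [eq_sub_iff_add_eq', ← measureReal_inter_add_sdiff (s := C) hm]
  congr 2
  ext ω
  simp

lemma IsHistory.step_zero {p : I} {i : ℤ} {C : Set SpinConfig} (hC : IsHistory p i 0 C) (n' : ℕ∞) :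
    IsHistory p (i + 1) n' (C ∩ {ω | statePath ω (i + 1) = n'}) ∧
      (bernoulliField p).real (C ∩ {ω | statePath ω (i + 1) = n'}) =
        (bernoulliField p).real C * ghocTransition p 0 n' := by
  have h1 : ∀ ω ∈ C, statePath ω (i + 1) = 1 := fun ω hω =>
    (gapState_thinning_of_eq_zero (hC.statePath_eq ω hω)).2
  by_cases hn : n' = 1
  · subst hn
    have hD : C ∩ {ω | statePath ω (i + 1) = 1} = C := Set.inter_eq_left.2 h1
    rw [hD]
    exact ⟨isHistory_of_past hC.measurableSet h1 (by simp [emptyProb]), by simp [ghocTransition]⟩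
  · have hD : C ∩ {ω | statePath ω (i + 1) = n'} = ∅ :=
      Set.eq_empty_of_forall_notMem fun ω hω => hn (hω.2.symm.trans (h1 ω hω.1))
    rw [hD]
    exact ⟨isHistory_of_null (@MeasurableSet.empty _ (pastSigma _)) (by simp) (by simp),
      by simp [ghocTransition, hn]⟩

lemma ghocTransition_one_left (p : ℝ) (n : ℕ∞) :
    ghocTransition p 1 n = if n = 1 then p else if n = 2 then 1 - p else 0 := by
  unfold ghocTransition
  rw [one_add_one_eq_two]
  by_cases h1 : n = 1
  · simp [h1]
  · by_cases h2 : n = 2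
    · simp [h2, gFun]
    · simp [h1, h2]

lemma ghocTransition_of_two_le {p : ℝ} {i : ℕ∞} (h0 : i ≠ 0) (h1 : i ≠ 1) (n : ℕ∞) :
    ghocTransition p i n = if n = i + 1 then gFun p i else if n = 0 then 1 - gFun p i else 0 := by
  simp [ghocTransition, h0, h1]

lemma IsHistory.step_one {p : I} (hp0 : 0 < (p : ℝ)) (hp1 : (p : ℝ) < 1) {i : ℤ}
    {C : Set SpinConfig} (hC : IsHistory p i 1 C) (n' : ℕ∞) :
    IsHistory p (i + 1) n' (C ∩ {ω | statePath ω (i + 1) = n'}) ∧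
      (bernoulliField p).real (C ∩ {ω | statePath ω (i + 1) = n'}) =
        (bernoulliField p).real C * ghocTransition p 1 n' := by
  have hs : ∀ ω ∈ C, statePath ω (i + 1) = if ω (i + 1) = 1 then 1 else 2 := fun ω hω =>
    gapState_thinning_of_eq_one (hC.statePath_eq ω hω)
  have hr := hC.real_inter
  have h12 : (2 : ℕ∞) ≠ 1 := by norm_num
  have he : emptyProb p 1 = 1 - p := by simp [emptyProb]
  rw [ghocTransition_one_left]
  by_cases hn : n' = 1
  · subst hn
    have hD : C ∩ {ω | statePath ω (i + 1) = 1} = C ∩ {ω | ω (i + 1) = 1} := by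
      ext ω
      refine and_congr_right fun hω => ?_
      by_cases h : ω (i + 1) = 1 <;> simp [hs ω hω, h]
    refine ⟨isHistory_of_past ?_ (fun ω hω => hω.2) he, ?_⟩
    · rw [hD]
      exact hC.measurableSet.inter (measurableSet_eval_pastSigma le_rfl {1})
    · rw [hD, bernoulliField_real_inter_eq_one, hr, he,
        if_pos rfl]
      ring
  by_cases hn2 : n' = 2
  · subst hn2
    have hD : C ∩ {ω | statePath ω (i + 1) = 2} = C ∩ {ω | ω (i + 1) ≠ 1} := by
      ext ω
      refine and_congr_right fun hω => ?_
      by_cases h : ω (i + 1) = 1 <;> simp [hs ω hω, h]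
    refine ⟨isHistory_of_past ?_ (fun ω hω => hω.2) (emptyProb_two hp0 hp1), ?_⟩
    · rw [hD]
      exact hC.measurableSet.inter (measurableSet_eval_pastSigma le_rfl {1}ᶜ)
    · rw [hD, hr, he, if_neg hn, if_pos rfl]
      ring
  · have hD : C ∩ {ω | statePath ω (i + 1) = n'} = ∅ := by
      refine Set.eq_empty_of_forall_notMem fun ω hω => ?_
      have h1 := hs ω hω.1
      rw [hω.2] at h1
      split_ifs at h1
      exacts [hn h1, hn2 h1]
    rw [hD]
    exact ⟨isHistory_of_null (@MeasurableSet.empty _ (pastSigma _)) (by simp) (by simp), by simp [hn, hn2]⟩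

/-- Split according to site `i + 2`, which is independent of both `C` and site `i + 1`. -/
lemma bernoulliField_real_diff_eq_one {p : I} {i : ℤ} {C : Set SpinConfig}
    (hC : MeasurableSet[pastSigma (i + 1)] C) :
    (bernoulliField p).real (C \ {ω | ω (i + 1) = 1 ∧ ω (i + 1 + 1) = 1}) =
      (1 - p) * (bernoulliField p).real C +
        p * (bernoulliField p).real (C ∩ {ω | ω (i + 1) ≠ 1}) := by
  have hm : MeasurableSet[pastSigma (i + 1)] (C ∩ {ω | ω (i + 1) ≠ 1}) :=
    hC.inter (measurableSet_eval_pastSigma le_rfl {1}ᶜ)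
  have hD : C \ {ω | ω (i + 1) = 1 ∧ ω (i + 1 + 1) = 1} =
      (C ∩ {ω | ω (i + 1 + 1) ≠ 1}) ∪
        ((C ∩ {ω | ω (i + 1) ≠ 1}) ∩ {ω | ω (i + 1 + 1) = 1}) := by
    ext ω
    simp only [Set.mem_sdiff, Set.mem_union, Set.mem_inter_iff, Set.mem_ofPred_eq]
    tauto
  rw [hD, measureReal_union, bernoulliField_real_inter_ne_one p hC,
    bernoulliField_real_inter_eq_one, bernoulliField_real_inter_ne_one p hm]
  · ring
  · exact Set.disjoint_left.2 fun ω hω hω' => hω.2 hω'.2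
  · exact (pastSigma_le _ _ hm).inter (measurable_pi_apply _ (MeasurableSet.singleton 1))

lemma IsHistory.step_of_two_le {p : I} (hp0 : 0 < (p : ℝ)) (hp1 : (p : ℝ) < 1) {i : ℤ} {n : ℕ∞}
    {C : Set SpinConfig} (hC : IsHistory p i n C) (h0 : n ≠ 0) (h1 : n ≠ 1) (n' : ℕ∞) :
    IsHistory p (i + 1) n' (C ∩ {ω | statePath ω (i + 1) = n'}) ∧
      (bernoulliField p).real (C ∩ {ω | statePath ω (i + 1) = n'}) =
        (bernoulliField p).real C * ghocTransition p n n' := by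
  have hs : ∀ ω ∈ C, statePath ω (i + 1) =
      if ω (i + 1) = 1 ∧ ω (i + 1 + 1) = 1 then 0 else n + 1 := fun ω hω => by
    have := hC.statePath_eq ω hω
    rw [← this]
    exact gapState_thinning_of_two_le (fun h => h0 (this.symm.trans h))
      (fun h => h1 (this.symm.trans h))
  have hm : MeasurableSet[pastSigma (i + 1 + 1)] (C ∩ {ω | statePath ω (i + 1) = n'}) :=
    (pastSigma_mono (by linarith) C hC.measurableSet).inter (measurableSet_statePath le_rfl n')
  have hr : (bernoulliField p).real (C \ {ω | ω (i + 1) = 1 ∧ ω (i + 1 + 1) = 1}) =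
      (bernoulliField p).real C * gFun p n := by
    rw [bernoulliField_real_diff_eq_one hC.measurableSet, hC.real_inter, gFun_eq hp0 h0 h1]
    ring
  rw [ghocTransition_of_two_le h0 h1]
  by_cases hn : n' = n + 1
  · subst hn
    have hD : C ∩ {ω | statePath ω (i + 1) = n + 1} =
        C \ {ω | ω (i + 1) = 1 ∧ ω (i + 1 + 1) = 1} := by
      ext ω
      refine and_congr_right fun hω => ?_
      by_cases h : ω (i + 1) = 1 ∧ ω (i + 1 + 1) = 1 <;>
        simp [hs ω hω, h, (ne_of_lt (by simp) : (0 : ℕ∞) ≠ n + 1)]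
    -- Numerator of Bayes' rule: emptiness of `i + 2` makes the restriction to `n + 1` redundant.
    have hD' : (C ∩ {ω | statePath ω (i + 1) = n + 1}) ∩ {ω | ω (i + 1 + 1) ≠ 1} =
        C ∩ {ω | ω (i + 1 + 1) ≠ 1} := by
      rw [hD]
      ext ω
      simp only [Set.mem_sdiff, Set.mem_inter_iff, Set.mem_ofPred_eq]
      tauto
    refine ⟨⟨hm, fun ω hω => hω.2, ?_⟩, ?_⟩
    · rw [hD', bernoulliField_real_inter_ne_one p hC.measurableSet, hD, hr,
        ← emptyProb_add_one_mul hp0 hp1 h0 h1]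
      ring
    · rw [hD, hr, if_pos rfl]
  by_cases hn2 : n' = 0
  · subst hn2
    have hE : ∀ ω ∈ C ∩ {ω | statePath ω (i + 1) = 0}, ω (i + 1 + 1) = 1 := fun ω hω =>
      (gapState_thinning_of_eq_zero hω.2).1
    have hD : C ∩ {ω | statePath ω (i + 1) = 0} =
        C ∩ {ω | ω (i + 1) = 1 ∧ ω (i + 1 + 1) = 1} := by
      ext ω
      refine and_congr_right fun hω => ?_
      by_cases h : ω (i + 1) = 1 ∧ ω (i + 1 + 1) = 1 <;> simp [hs ω hω, h]
    refine ⟨⟨hm, fun ω hω => hω.2, ?_⟩, ?_⟩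
    · have : (C ∩ {ω | statePath ω (i + 1) = 0}) ∩ {ω | ω (i + 1 + 1) ≠ 1} = ∅ :=
        Set.eq_empty_of_forall_notMem fun ω hω => hω.2 (hE ω hω.1)
      rw [this]
      simp [emptyProb]
    · have hB : MeasurableSet {ω : SpinConfig | ω (i + 1) = 1 ∧ ω (i + 1 + 1) = 1} :=
        (measurable_pi_apply _ (MeasurableSet.singleton 1)).inter
          (measurable_pi_apply _ (MeasurableSet.singleton 1))
      have := measureReal_inter_add_sdiff (μ := bernoulliField p) (s := C) hB
      rw [hD, if_neg hn, if_pos rfl]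
      linarith
  · have hD : C ∩ {ω | statePath ω (i + 1) = n'} = ∅ := by
      refine Set.eq_empty_of_forall_notMem fun ω hω => ?_
      have h1 := hs ω hω.1
      rw [hω.2] at h1
      split_ifs at h1
      exacts [hn2 h1, hn h1]
    rw [hD]
    exact ⟨isHistory_of_null (@MeasurableSet.empty _ (pastSigma _)) (by simp) (by simp), by simp [hn, hn2]⟩

lemma IsHistory.step {p : I} (hp0 : 0 < (p : ℝ)) (hp1 : (p : ℝ) < 1) {i : ℤ} {n : ℕ∞}
    {C : Set SpinConfig} (hC : IsHistory p i n C) (n' : ℕ∞) :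
    IsHistory p (i + 1) n' (C ∩ {ω | statePath ω (i + 1) = n'}) ∧
      (bernoulliField p).real (C ∩ {ω | statePath ω (i + 1) = n'}) =
        (bernoulliField p).real C * ghocTransition p n n' := by
  by_cases h0 : n = 0
  · subst h0
    exact hC.step_zero n'
  by_cases h1 : n = 1
  · subst h1
    exact hC.step_one hp0 hp1 n'
  · exact hC.step_of_two_le hp0 hp1 h0 h1 n'

/-- A finite state `k + 2` at `i` forces `k + 1` at `i - 1`, so the event is one step of a shorter
history, down to state 1. -/
lemma isHistory_statePath_natCast {p : I} (hp0 : 0 < (p : ℝ)) (hp1 : (p : ℝ) < 1) (k : ℕ) (i : ℤ) :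
    IsHistory p i k {ω | statePath ω i = k} := by
  have hm : ∀ (i : ℤ) (n : ℕ∞), MeasurableSet[pastSigma (i + 1)] {ω | statePath ω i = n} :=
    fun i n => measurableSet_statePath le_rfl n
  match k with
  | 0 =>
    refine ⟨hm _ _, fun ω hω => hω, ?_⟩
    have : {ω | statePath ω i = (0 : ℕ)} ∩ {ω | ω (i + 1) ≠ 1} = ∅ :=
      Set.eq_empty_of_forall_notMem fun ω hω =>
        hω.2 (gapState_thinning_of_eq_zero (hω.1.trans Nat.cast_zero)).1
    rw [this]
    simp [emptyProb]
  | 1 =>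
    have h : {ω | statePath ω i = (1 : ℕ)} = {ω | ω i = 1} ∩ {ω | ω (i - 1) = 1} := by
      ext ω
      rw [Nat.cast_one]
      exact gapState_thinning_eq_one_iff
    refine isHistory_of_past ?_ (fun ω hω => hω) (by simp [emptyProb])
    rw [h]
    exact (measurableSet_eval_pastSigma le_rfl {1}).inter
      (measurableSet_eval_pastSigma (by linarith) {1})
  | k + 2 =>
    have ih := ((isHistory_statePath_natCast hp0 hp1 (k + 1) (i - 1)).step hp0 hp1
      ((k + 2 : ℕ) : ℕ∞)).1
    rw [sub_add_cancel] at ih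
    rwa [Set.inter_eq_right.2 fun ω hω => ?_] at ih
    refine gapState_thinning_sub_one (by simp) ?_
    rw [sub_add_cancel]
    refine Eq.trans (b := ((k + 2 : ℕ) : ℕ∞)) hω (by push_cast; ring)

lemma statePath_eq_top_iff (ω : SpinConfig) (i : ℤ) :
    statePath ω (i + 1) = ⊤ ↔ statePath ω i = ⊤ ∧ ¬(ω (i + 1) = 1 ∧ ω (i + 1 + 1) = 1) := by
  have hs : statePath ω i = ⊤ → statePath ω (i + 1) =
      if ω (i + 1) = 1 ∧ ω (i + 1 + 1) = 1 then 0 else ⊤ := fun h => by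
    have h' : gapState (thinning ω) i = ⊤ := h
    have h2 := gapState_thinning_of_two_le (ω := ω) (i := i) (by simp [h']) (by simp [h'])
    rwa [h', top_add] at h2
  constructor
  · intro h
    have h' : statePath ω i = ⊤ := gapState_thinning_sub_one (by simp) (h.trans (top_add 1).symm)
    refine ⟨h', fun h2 => ?_⟩
    rw [hs h', if_pos h2] at h
    simp at h
  · rintro ⟨h, h2⟩
    rw [hs h, if_neg h2]

/-- No finite descent starts the induction at `⊤`, so this event is shown to be null by comparing it
with its translate. -/
lemma bernoulliField_real_statePath_eq_top {p : I} (hp0 : 0 < (p : ℝ)) (i : ℤ) :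
    (bernoulliField p).real {ω | statePath ω i = ⊤} = 0 := by
  have hm : ∀ i, MeasurableSet[pastSigma (i + 1)] {ω | statePath ω i = ⊤} :=
    fun i => measurableSet_statePath le_rfl ⊤
  have hm2 : MeasurableSet[pastSigma (i + 1)] ({ω | statePath ω i = ⊤} ∩ {ω | ω (i + 1) ≠ 1}) :=
    (hm i).inter (measurableSet_eval_pastSigma le_rfl {1}ᶜ)
  have ht : (bernoulliField p).real {ω | statePath ω (i + 1) = ⊤} =
      (bernoulliField p).real {ω | statePath ω i = ⊤} := by
    rw [← (measurePreserving_shift p).measureReal_preimage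
      (pastSigma_le _ _ (hm i)).nullMeasurableSet]
    simp only [Set.preimage_ofPred_eq, statePath_shift]
  have hu : (bernoulliField p).real ({ω | statePath ω (i + 1) = ⊤} ∩ {ω | ω (i + 1 + 1) ≠ 1}) =
      (bernoulliField p).real ({ω | statePath ω i = ⊤} ∩ {ω | ω (i + 1) ≠ 1}) := by
    rw [← (measurePreserving_shift p).measureReal_preimage
      (pastSigma_le _ _ hm2).nullMeasurableSet]
    simp only [Set.preimage_inter, Set.preimage_ofPred_eq, statePath_shift]
    rfl
  have hD : {ω | statePath ω (i + 1) = ⊤} =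
      {ω | statePath ω i = ⊤} \ {ω | ω (i + 1) = 1 ∧ ω (i + 1 + 1) = 1} :=
    Set.ext fun ω => statePath_eq_top_iff ω i
  have hD' : {ω | statePath ω (i + 1) = ⊤} ∩ {ω | ω (i + 1 + 1) ≠ 1} =
      {ω | statePath ω i = ⊤} ∩ {ω | ω (i + 1 + 1) ≠ 1} := by
    rw [hD]
    ext ω
    simp only [Set.mem_sdiff, Set.mem_inter_iff, Set.mem_ofPred_eq]
    tauto
  rw [hD', bernoulliField_real_inter_ne_one p (hm i)] at hu
  rw [hD, bernoulliField_real_diff_eq_one (hm i), ← hu] at ht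
  -- With `a` the probability of `⊤`, shift invariance has given `a = (1 - p) a + p (1 - p) a`.
  have : (p : ℝ) ^ 2 * (bernoulliField p).real {ω | statePath ω i = ⊤} = 0 := by
    linear_combination -ht
  exact (mul_eq_zero.1 this).resolve_left (pow_pos hp0 2).ne'

lemma isHistory_statePath {p : I} (hp0 : 0 < (p : ℝ)) (hp1 : (p : ℝ) < 1) (n : ℕ∞) (i : ℤ) :
    IsHistory p i n {ω | statePath ω i = n} := by
  by_cases hn : n = ⊤
  · subst hn
    exact isHistory_of_null (measurableSet_statePath le_rfl _) (fun ω hω => hω)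
      (bernoulliField_real_statePath_eq_top hp0 i)
  · lift n to ℕ using hn
    exact isHistory_statePath_natCast hp0 hp1 n i

/-! ### Finite windows and existence -/

lemma measurableSet_window {S : Type*} [MeasurableSpace S] [MeasurableSingletonClass S]
    (m : ℤ) (k : ℕ) (s : ℕ → S) : MeasurableSet {x : ℤ → S | ∀ i ≤ k, x (m + (i : ℤ)) = s i} := by
  simp only [Set.ofPred_forall]
  exact MeasurableSet.iInter fun i => MeasurableSet.iInter fun _ =>
    measurable_pi_apply _ (MeasurableSet.singleton _)

lemma window_add_one {S Ω : Type*} (X : Ω → ℤ → S) (m : ℤ) (k : ℕ) (s : ℕ → S) :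
    {ω | ∀ i ≤ k + 1, X ω (m + (i : ℤ)) = s i} =
      {ω | ∀ i ≤ k, X ω (m + (i : ℤ)) = s i} ∩ {ω | X ω (m + k + 1) = s (k + 1)} := by
  ext ω
  simp only [Set.mem_ofPred_eq, Set.mem_inter_iff, Nat.le_succ_iff]
  have : m + ((k + 1 : ℕ) : ℤ) = m + k + 1 := by push_cast; ring
  constructor
  · intro h
    exact ⟨fun i hi => h i (Or.inl hi), this ▸ h (k + 1) (Or.inr rfl)⟩
  · rintro ⟨h, h'⟩ i (hi | rfl)
    exacts [h i hi, this.symm ▸ h']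

lemma isHistory_window {p : I} (hp0 : 0 < (p : ℝ)) (hp1 : (p : ℝ) < 1) (m : ℤ) (s : ℕ → ℕ∞)
    (k : ℕ) : IsHistory p (m + k) (s k) {ω | ∀ i ≤ k, statePath ω (m + (i : ℤ)) = s i} := by
  induction k with
  | zero => simpa using isHistory_statePath hp0 hp1 (s 0) m
  | succ k ih =>
    have := (ih.step hp0 hp1 (s (k + 1))).1
    rw [← window_add_one] at this
    rwa [Nat.cast_add, Nat.cast_one, ← add_assoc]

lemma isStationaryMarkovLaw_map_statePath {p : I} (hp0 : 0 < (p : ℝ)) (hp1 : (p : ℝ) < 1) :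
    IsStationaryMarkovLaw (ghocTransition p) ((bernoulliField p).map statePath) where
  isProbabilityMeasure := Measure.isProbabilityMeasure_map measurable_statePath.aemeasurable
  stationary := by
    change Measure.map (shift ℕ∞) _ = _
    conv_rhs => rw [← (measurePreserving_shift p).map_eq]
    rw [Measure.map_map (measurable_shift _) measurable_statePath,
      Measure.map_map measurable_statePath (measurable_shift _)]
    congr 1
    funext ω i
    exact (statePath_shift ω i).symm
  markov m k s := by
    rw [map_measureReal_apply measurable_statePath (measurableSet_window _ _ _),
      map_measureReal_apply measurable_statePath (measurableSet_window _ _ _)]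
    simp only [Set.preimage_ofPred_eq]
    rw [window_add_one]
    exact ((isHistory_window hp0 hp1 m s k).step hp0 hp1 (s (k + 1))).2

/-! ### Stationary Markov laws are determined by one-site weights -/

section Uniqueness

variable {S : Type*} [MeasurableSpace S] {K : S → S → ℝ} {P P' : Measure (ℤ → S)}

lemma IsStationaryMarkovLaw.real_eval [MeasurableSingletonClass S]
    (h : IsStationaryMarkovLaw K P) (m : ℤ) (a : S) :
    P.real {x | x m = a} = P.real {x | x 0 = a} := by
  have step : ∀ m : ℤ, P.real {x | x (m + 1) = a} = P.real {x | x m = a} := fun m => by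
    have hm : MeasurableSet {x : ℤ → S | x m = a} :=
      measurable_pi_apply (X := fun _ : ℤ => S) m (MeasurableSet.singleton a)
    conv_rhs => rw [← h.stationary]
    exact (map_measureReal_apply (measurable_shift S) hm).symm
  induction m with
  | zero => rfl
  | succ i ih => rw [step, ih]
  | pred i ih => rw [← ih, ← step, sub_add_cancel]

lemma IsStationaryMarkovLaw.real_window [MeasurableSingletonClass S]
    (h : IsStationaryMarkovLaw K P) (m : ℤ) (k : ℕ) (s : ℕ → S) :
    P.real {x | ∀ i ≤ k, x (m + (i : ℤ)) = s i} =
      P.real {x | x 0 = s 0} * ∏ i ∈ Finset.range k, K (s i) (s (i + 1)) := by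
  induction k with
  | zero => simpa using h.real_eval m (s 0)
  | succ k ih => rw [h.markov, ih, Finset.prod_range_succ, mul_assoc]

lemma IsStationaryMarkovLaw.real_pair (h : IsStationaryMarkovLaw K P) (a b : S) :
    P.real ({x | x 1 = b} ∩ {x | x 0 = a}) = P.real {x | x 0 = a} * K a b := by
  have := h.markov 0 0 fun i => if i = 0 then a else b
  rw [window_add_one (fun x : ℤ → S => x)] at this
  simpa [Set.inter_comm] using this

lemma hasSum_measureReal_inter_eq [Countable S] [MeasurableSingletonClass S] {Ω : Type*}
    [MeasurableSpace Ω] (μ : Measure Ω) [IsFiniteMeasure μ] {X : Ω → S} (hX : Measurable X)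
    (A : Set Ω) : HasSum (fun a => μ.real (A ∩ {ω | X ω = a})) (μ.real A) := by
  have hm : ∀ a, MeasurableSet {ω | X ω = a} := fun a => hX (MeasurableSet.singleton a)
  have hU : ⋃ a, {ω | X ω = a} = Set.univ := Set.eq_univ_of_forall fun ω => by simp
  have h := measure_iUnion (μ := μ.restrict A) (f := fun a => {ω | X ω = a})
    (fun a b hab => Set.disjoint_left.2 fun ω ha hb => hab (ha.symm.trans hb)) hm
  rw [hU, Measure.restrict_apply_univ] at h
  simp only [Measure.restrict_apply (hm _), Set.inter_comm _ A] at h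
  have hne : ∀ a, μ (A ∩ {ω | X ω = a}) ≠ ⊤ := fun a => measure_ne_top _ _
  rw [measureReal_def, h, ENNReal.tsum_toReal_eq hne]
  refine (ENNReal.summable_toReal ?_).hasSum
  rw [← h]
  exact measure_ne_top _ _

lemma IsStationaryMarkovLaw.real_eq_sum [Countable S] [MeasurableSingletonClass S]
    (h : IsStationaryMarkovLaw K P) (b : S) (F : Finset S) (hF : ∀ a ∉ F, K a b = 0) :
    P.real {x | x 0 = b} = ∑ a ∈ F, P.real {x | x 0 = a} * K a b := by
  have := h.isProbabilityMeasure
  have hs := hasSum_measureReal_inter_eq P (measurable_pi_apply (0 : ℤ)) {x : ℤ → S | x 1 = b}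
  simp only [h.real_pair, h.real_eval 1 b] at hs
  exact hs.unique (hasSum_sum_of_ne_finset_zero fun a ha => by rw [hF a ha, mul_zero])

lemma IsStationaryMarkovLaw.hasSum_real [Countable S] [MeasurableSingletonClass S]
    (h : IsStationaryMarkovLaw K P) : HasSum (fun a => P.real {x | x 0 = a}) 1 := by
  have := h.isProbabilityMeasure
  simpa using hasSum_measureReal_inter_eq P (measurable_pi_apply (0 : ℤ)) Set.univ

/-- Window probabilities are products of a one-site weight and transition entries. Every finite set
of sites lies in a window, so all finite-dimensional marginals agree. -/
lemma IsStationaryMarkovLaw.eq_of_real_eq [Countable S] [MeasurableSingletonClass S]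
    (h : IsStationaryMarkovLaw K P) (h' : IsStationaryMarkovLaw K P')
    (hπ : ∀ a, P.real {x | x 0 = a} = P'.real {x | x 0 = a}) : P = P' := by
  have := h.isProbabilityMeasure
  have := h'.isProbabilityMeasure
  have key : ∀ (m : ℤ) (k : ℕ),
      P.map (fun x (i : Fin (k + 1)) => x (m + (i : ℕ))) =
        P'.map (fun x (i : Fin (k + 1)) => x (m + (i : ℕ))) := fun m k => by
    have hr : Measurable fun (x : ℤ → S) (i : Fin (k + 1)) => x (m + (i : ℕ)) := by fun_prop
    refine Measure.ext_of_singleton fun y => ?_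
    -- `Fin.ofNat` extends `y` to all of `ℕ`; no index `i ≤ k` wraps around.
    have hpre : (fun (x : ℤ → S) (i : Fin (k + 1)) => x (m + (i : ℕ))) ⁻¹' {y} =
        {x | ∀ i ≤ k, x (m + (i : ℤ)) = y (Fin.ofNat (k + 1) i)} := by
      ext x
      simp only [Set.mem_preimage, Set.mem_singleton_iff, funext_iff, Set.mem_ofPred_eq]
      constructor
      · intro hx i hi
        rw [← hx, Fin.val_ofNat, Nat.mod_eq_of_lt (by omega)]
      · intro hx i
        rw [hx i (by omega), Fin.ofNat_val_eq_self]
    rw [Measure.map_apply hr (MeasurableSet.singleton y),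
      Measure.map_apply hr (MeasurableSet.singleton y), hpre, ← ofReal_measureReal,
      ← ofReal_measureReal, h.real_window m k fun i => y (Fin.ofNat (k + 1) i),
      h'.real_window m k fun i => y (Fin.ofNat (k + 1) i), hπ]
  refine IsProjectiveLimit.unique (P := fun J : Finset ℤ => P'.map J.restrict) (fun J => ?_)
    fun _ => rfl
  obtain ⟨m, hm⟩ := J.bddBelow
  obtain ⟨M, hM⟩ := J.bddAbove
  let k := (M - m).toNat
  have hk : ∀ j ∈ J, m + ((j - m).toNat : ℤ) = j ∧ (j - m).toNat < k + 1 := fun j hj => by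
    have := hm hj
    have := hM hj
    omega
  let φ : (Fin (k + 1) → S) → (J → S) := fun y j => y ⟨(j - m).toNat, (hk j j.2).2⟩
  have hφ : Measurable φ := measurable_pi_lambda _ fun _ => measurable_pi_apply _
  have hcomp : J.restrict = φ ∘ fun (x : ℤ → S) (i : Fin (k + 1)) => x (m + (i : ℕ)) := by
    funext x j
    simp only [Finset.restrict, φ, Function.comp_apply, (hk j j.2).1]
  change P.map J.restrict = P'.map J.restrict
  rw [hcomp, ← Measure.map_map hφ (by fun_prop), ← Measure.map_map hφ (by fun_prop), key]

end Uniqueness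

/-! ### Uniqueness for the GHoC chain -/

lemma ghocTransition_add_one_right {p : ℝ} {n : ℕ∞} (hn : n ≠ 0) :
    ghocTransition p n (n + 1) = gFun p n := by
  simp [ghocTransition, hn]

lemma ghocTransition_add_one_right_eq_zero {p : ℝ} {n a : ℕ∞} (hn : n ≠ 0) (ha : a ≠ n) :
    ghocTransition p a (n + 1) = 0 := by
  have inj := ENat.add_left_injective_of_ne_top (n := 1) (by simp)
  have h1 : n + 1 ≠ 1 := fun h => hn (inj (h.trans (zero_add 1).symm))
  have h2 : n + 1 ≠ a + 1 := fun h => ha (inj h).symm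
  simp [ghocTransition, h1, h2]

lemma IsStationaryMarkovLaw.ghoc_add_one {p : ℝ} {P : Measure (ℤ → ℕ∞)}
    (h : IsStationaryMarkovLaw (ghocTransition p) P) {n : ℕ∞} (hn : n ≠ 0) :
    P.real {x | x 0 = n + 1} = P.real {x | x 0 = n} * gFun p n := by
  rw [h.real_eq_sum (n + 1) {n} fun a ha =>
      ghocTransition_add_one_right_eq_zero hn (by simpa using ha),
    Finset.sum_singleton, ghocTransition_add_one_right hn]

lemma IsStationaryMarkovLaw.ghoc_top {p : ℝ} (hp0 : 0 < p) (hp1 : p < 1) {P : Measure (ℤ → ℕ∞)}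
    (h : IsStationaryMarkovLaw (ghocTransition p) P) : P.real {x | x 0 = ⊤} = 0 := by
  have h1 := h.ghoc_add_one (n := ⊤) (by simp)
  rw [top_add, gFun_top] at h1
  have : P.real {x | x 0 = ⊤} * (1 - lambdaPF p) = 0 := by linear_combination h1
  exact (mul_eq_zero.1 this).resolve_right (sub_pos.2 (lambdaPF_lt_one hp0 hp1)).ne'

/-- Balance at state 1, which is entered only from 0 and from itself. -/
lemma IsStationaryMarkovLaw.ghoc_one {p : ℝ} {P : Measure (ℤ → ℕ∞)}
    (h : IsStationaryMarkovLaw (ghocTransition p) P) :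
    (1 - p) * P.real {x | x 0 = 1} = P.real {x | x 0 = 0} := by
  have h1 := h.real_eq_sum 1 {0, 1} fun a ha => by
    simp only [Finset.mem_insert, Finset.mem_singleton, not_or] at ha
    rw [ghocTransition_of_two_le ha.1 ha.2, if_neg, if_neg one_ne_zero]
    intro h
    exact ha.1 (ENat.add_left_injective_of_ne_top (n := 1) (by simp)
      (h.symm.trans (zero_add 1).symm))
  rw [Finset.sum_pair zero_ne_one, ghocTransition_one_left, if_pos rfl] at h1
  have : ghocTransition p 0 1 = 1 := by simp [ghocTransition]
  rw [this] at h1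
  linear_combination h1

lemma IsStationaryMarkovLaw.ghoc_proportional {p : ℝ} (hp0 : 0 < p) (hp1 : p < 1)
    {P P' : Measure (ℤ → ℕ∞)} (h : IsStationaryMarkovLaw (ghocTransition p) P)
    (h' : IsStationaryMarkovLaw (ghocTransition p) P') (n : ℕ∞) :
    P.real {x | x 0 = n} * P'.real {x | x 0 = 0} =
      P'.real {x | x 0 = n} * P.real {x | x 0 = 0} := by
  by_cases hn : n = ⊤
  · rw [hn, h.ghoc_top hp0 hp1, h'.ghoc_top hp0 hp1, zero_mul, zero_mul]
  lift n to ℕ using hn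
  match n with
  | 0 => exact mul_comm _ _
  | k + 1 =>
    induction k with
    | zero =>
      rw [zero_add, Nat.cast_one, ← h.ghoc_one, ← h'.ghoc_one]
      ring
    | succ k ih =>
      rw [Nat.cast_add (k + 1) 1, Nat.cast_one, h.ghoc_add_one (by simp),
        h'.ghoc_add_one (by simp)]
      linear_combination gFun p ((k + 1 : ℕ) : ℕ∞) * ih

lemma IsStationaryMarkovLaw.ghoc_unique {p : ℝ} (hp0 : 0 < p) (hp1 : p < 1)
    {P P' : Measure (ℤ → ℕ∞)} (h : IsStationaryMarkovLaw (ghocTransition p) P)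
    (h' : IsStationaryMarkovLaw (ghocTransition p) P') : P = P' := by
  have hprop := h.ghoc_proportional hp0 hp1 h'
  have h0 : P'.real {x | x 0 = 0} = P.real {x | x 0 = 0} := by
    -- Summing the proportionality over all states equates the weights at 0.
    have hs := h.hasSum_real.mul_right (P'.real {x | x 0 = 0})
    simp only [hprop] at hs
    simpa using hs.unique (h'.hasSum_real.mul_right (P.real {x | x 0 = 0}))
  rw [h0] at hprop
  -- Zero weight at 0 would spread to every state, against total mass 1.
  have hne : P.real {x | x 0 = 0} ≠ 0 := fun hz => by
    have hall : ∀ n, P.real {x | x 0 = n} = 0 := fun n => by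
      by_cases hn : n = ⊤
      · rw [hn, h.ghoc_top hp0 hp1]
      lift n to ℕ using hn
      match n with
      | 0 => exact hz
      | k + 1 =>
        induction k with
        | zero =>
          have := h.ghoc_one
          rw [hz] at this
          exact (mul_eq_zero.1 this).resolve_left (sub_pos.2 hp1).ne'
        | succ k ih =>
          rw [Nat.cast_add (k + 1) 1, Nat.cast_one, h.ghoc_add_one (by simp), ih, zero_mul]
    have hs := h.hasSum_real
    simp only [hall] at hs
    exact zero_ne_one (hasSum_zero.unique hs)
  exact h.eq_of_real_eq h' fun n => mul_right_cancel₀ hne (hprop n)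

/-! ### The factor map onto the thinned field -/

lemma measurable_map_tau : Measurable fun (n : ℤ → ℕ∞) (i : ℤ) => tau (n i) :=
  measurable_pi_lambda _ fun i => (measurable_of_countable tau).comp (measurable_pi_apply i)

lemma map_tau_map_statePath (p : I) :
    ((bernoulliField p).map statePath).map (fun (n : ℤ → ℕ∞) (i : ℤ) => tau (n i)) =
      thinnedBernoulliField p := by
  rw [Measure.map_map measurable_map_tau measurable_statePath, thinnedBernoulliField]
  congr 1
  funext ω i
  exact tau_gapState _ i

theorem mainTheorem6 (p : I) (hp0 : 0 < p) (hp1 : p < 1) :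
    ∃ P : Measure (ℤ → ℕ∞),
      IsStationaryMarkovLaw (ghocTransition p) P ∧
      (∀ P' : Measure (ℤ → ℕ∞), IsStationaryMarkovLaw (ghocTransition p) P' → P' = P) ∧
      P.map (fun (n : ℤ → ℕ∞) (i : ℤ) => tau (n i)) = thinnedBernoulliField p ∧
      ∀ (E : Type*) [MeasurableSpace E] (Q : Measure E) (X : ℤ → E → ℕ∞),
        HasLaw (fun (e : E) (i : ℤ) => X i e) P Q →
          HasLaw (fun (e : E) (i : ℤ) => tau (X i e)) (thinnedBernoulliField p) Q := by
  have h0 : 0 < (p : ℝ) := hp0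
  have h1 : (p : ℝ) < 1 := hp1
  have hP := isStationaryMarkovLaw_map_statePath h0 h1
  refine ⟨_, hP, fun P' hP' => hP'.ghoc_unique h0 h1 hP, map_tau_map_statePath p,
    fun E _ Q X hX => ⟨measurable_map_tau.comp_aemeasurable hX.aemeasurable, ?_⟩⟩
  rw [← map_tau_map_statePath, ← hX.map_eq, AEMeasurable.map_map_of_aemeasurable
    measurable_map_tau.aemeasurable hX.aemeasurable]
  rfl
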